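/- Let $b>0$ and $\sigma\in L_2(0,b)$. Let $L$ be the operator in $L_2(0,b)$ given by $Ly=-iy'$ with domain $D(L)=\{y\in W_2^1[0,b]:\ y(0)-\int_0^b(-iy'(x))\overline{\sigma(x)}\,dx=0\}$, let $\sigma(L)$ be its spectrum, and put $\Delta(\lambda)=1-\lambda\int_0^b e^{i\lambda x}\,\overline{\sigma(x)}\,dx$. For $\lambda_n\in\sigma(L)$ let $m_n$ be the multiplicity of $\lambda_n$ as a zero of the entire function $\Delta$, let $d_{j,n}$ be the value at $\lambda_n$ of the $j$-th derivative of $(\lambda-\lambda_n)^{m_n}/\Delta(\lambda)$ (with its removable singularity at $\lambda_n$ removed), and for $0\le k\le m_n-1$ put $$u_{k,n}(x)=\sum_{j=0}^{k}\frac{d_{j,n}}{j!}\,\frac{(ix)^{k-j}}{(k-j)!}\,e^{i\lambda_n x}.$$ These are root functions of $L$: $u_{k,n}\in D(L)$, $(L-\lambda_n)u_{0,n}=0$ and $(L-\lambda_n)u_{k,n}=u_{k-1,n}$ for $1\le k\le m_n-1$. Theorem. The system $\{u_{k,n}:\ \lambda_n\in\sigma(L),\ 0\le k\le m_n-1\}$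 is minimal in $L_2(0,b)$, that is, no $u_{k,n}$ belongs to the closed linear span of the others. Moreover, with $$h_{k,n}(\xi)=\delta_{k,0}\,\overline{\sigma(\xi)}+\int_\xi^b\overline{\sigma(\mu)}\,\frac{\partial}{\partial\mu}\Big(\frac{(i(\mu-\xi))^k}{k!}\,e^{i\lambda_n(\mu-\xi)}\Big)d\mu ,\qquad 0\le k\le m_n-1,$$ the functions $-\overline{h_{m_n-1-k,n}}$ lie in $L_2(0,b)$ and form a system biorthogonal to $\{u_{k,n}\}$: $$-\int_0^b u_{s,l}(\xi)\,h_{m_n-1-k,n}(\xi)\,d\xi=\delta_{l,n}\,\delta_{s,k}$$ for all $\lambda_l,\lambda_n\in\sigma(L)$, $0\le s\le m_l-1$, $0\le k\le m_n-1$. -/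

import Mathlib

open MeasureTheory Filter Topology

namespace FirstOrderBVP

noncomputable section

/-- Lebesgue measure on the interval `(0, b)`. -/
abbrev vol (b : ℝ) : Measure ℝ := volume.restrict (Set.Ioo 0 b)

/-- The complex Hilbert space `L₂(0, b)`. -/
abbrev L2 (b : ℝ) : Type := Lp ℂ 2 (vol b)

/-- The function `Y` on `[0, b]` lies in the Sobolev space `W¹₂[0, b]` and has derivative `g`:
it is a primitive of the square integrable function `g`. -/
def IsW12 (b : ℝ) (Y : ℝ → ℂ) (g : L2 b) : Prop :=
  ∀ x ∈ Set.Icc 0 b, Y x = Y 0 + ∫ t in (0 : ℝ)..x, g t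

/-- The boundary form `U(y) = y(0) - ∫₀ᵇ (-i y'(x)) conj (σ x) dx`, for `Y` with derivative `g`. -/
def boundaryForm (b : ℝ) (σ : L2 b) (Y : ℝ → ℂ) (g : L2 b) : ℂ :=
  Y 0 - ∫ x, (-Complex.I * g x) * starRingEnd ℂ (σ x) ∂(vol b)

lemma L2.integrable {b : ℝ} (g : L2 b) : Integrable g (vol b) :=
  (Lp.memLp g).integrable (by norm_num)

lemma L2.integrable_mul_conj {b : ℝ} (g σ : L2 b) (c : ℂ) :
    Integrable (fun x => (c * g x) * starRingEnd ℂ (σ x)) (vol b) := by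
  have h := MeasureTheory.L2.integrable_inner (𝕜 := ℂ) σ g
  refine (h.const_mul c).congr (Eventually.of_forall fun x => ?_)
  simp [RCLike.inner_apply, mul_assoc]

lemma L2.intervalIntegrable {b : ℝ} (g : L2 b) {x : ℝ} (hx : x ∈ Set.Icc 0 b) :
    IntervalIntegrable g volume 0 x := by
  rw [intervalIntegrable_iff_integrableOn_Ioo_of_le hx.1]
  exact IntegrableOn.mono_set (L2.integrable g) (Set.Ioo_subset_Ioo_right hx.2)

lemma intervalIntegral_eq {b x : ℝ} (hx : x ∈ Set.Icc 0 b) (f : ℝ → ℂ) :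
    ∫ t in (0 : ℝ)..x, f t = ∫ t in Set.Ioo 0 x, f t ∂(vol b) := by
  rw [intervalIntegral.integral_of_le hx.1, integral_Ioc_eq_integral_Ioo,
    Measure.restrict_restrict measurableSet_Ioo,
    Set.inter_eq_left.2 (Set.Ioo_subset_Ioo_right hx.2)]

lemma intervalIntegral_congr_ae {b x : ℝ} (hx : x ∈ Set.Icc 0 b) {f g : ℝ → ℂ}
    (h : f =ᵐ[vol b] g) : ∫ t in (0 : ℝ)..x, f t = ∫ t in (0 : ℝ)..x, g t := by
  rw [intervalIntegral_eq hx, intervalIntegral_eq hx]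
  exact integral_congr_ae (ae_restrict_of_ae h)

/-- The graph of the operator `L y = -i y'` with domain
`D(L) = {y ∈ W¹₂[0, b] : U(y) = 0}`: all pairs `(y, -i y')`. -/
def graphL (b : ℝ) (σ : L2 b) : Submodule ℂ (L2 b × L2 b) where
  carrier := {p | ∃ (Y : ℝ → ℂ) (g : L2 b), p.1 =ᵐ[vol b] Y ∧ IsW12 b Y g ∧
    boundaryForm b σ Y g = 0 ∧ p.2 = -Complex.I • g}
  zero_mem' := by
    refine ⟨0, 0, Lp.coeFn_zero _ _ _, fun x hx => ?_, ?_, by simp⟩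
    · rw [intervalIntegral_congr_ae hx (Lp.coeFn_zero ℂ 2 (vol b))]; simp
    · have : (fun x => (-Complex.I * (0 : L2 b) x) * starRingEnd ℂ (σ x)) =ᵐ[vol b] 0 := by
        filter_upwards [Lp.coeFn_zero ℂ 2 (vol b)] with x hx
        rw [hx]; simp
      unfold boundaryForm
      rw [integral_congr_ae this]; simp
  add_mem' := by
    rintro ⟨y, f⟩ ⟨y', f'⟩ ⟨Y, g, h1, h2, h3, h4⟩ ⟨Y', g', h1', h2', h3', h4'⟩
    simp only at h1 h4 h1' h4'
    refine ⟨Y + Y', g + g', ?_, fun x hx => ?_, ?_, ?_⟩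
    · filter_upwards [h1, h1', Lp.coeFn_add y y'] with x a a' e
      simp only [Prod.mk_add_mk]
      rw [e]; simp [a, a']
    · rw [intervalIntegral_congr_ae hx (Lp.coeFn_add g g')]
      have := intervalIntegral.integral_add (L2.intervalIntegrable g hx)
        (L2.intervalIntegrable g' hx)
      simp only [Pi.add_apply]
      rw [this, h2 x hx, h2' x hx]; ring
    · have : (fun x => (-Complex.I * (g + g' : L2 b) x) * starRingEnd ℂ (σ x)) =ᵐ[vol b]
          fun x => (-Complex.I * g x) * starRingEnd ℂ (σ x)
            + (-Complex.I * g' x) * starRingEnd ℂ (σ x) := by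
        filter_upwards [Lp.coeFn_add g g'] with x hx
        rw [hx]; simp only [Pi.add_apply]; ring
      unfold boundaryForm at *
      rw [integral_congr_ae this, integral_add (L2.integrable_mul_conj _ _ _)
        (L2.integrable_mul_conj _ _ _)]
      simp only [Pi.add_apply]
      linear_combination h3 + h3'
    · simp [h4, h4']
  smul_mem' := by
    rintro c ⟨y, f⟩ ⟨Y, g, h1, h2, h3, h4⟩
    simp only at h1 h4
    refine ⟨c • Y, c • g, ?_, fun x hx => ?_, ?_, ?_⟩
    · filter_upwards [h1, Lp.coeFn_smul c y] with x a e
      simp only [Prod.smul_mk]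
      rw [e]; simp [a]
    · rw [intervalIntegral_congr_ae hx (Lp.coeFn_smul c g)]
      simp only [Pi.smul_apply, smul_eq_mul]
      rw [intervalIntegral.integral_const_mul, h2 x hx]; ring
    · have : (fun x => (-Complex.I * (c • g : L2 b) x) * starRingEnd ℂ (σ x)) =ᵐ[vol b]
          fun x => c * ((-Complex.I * g x) * starRingEnd ℂ (σ x)) := by
        filter_upwards [Lp.coeFn_smul c g] with x hx
        rw [hx]; simp only [Pi.smul_apply, smul_eq_mul]; ring
      unfold boundaryForm at *
      rw [integral_congr_ae this, integral_const_mul]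
      simp only [Pi.smul_apply, smul_eq_mul]
      linear_combination c * h3
    · simp only [Prod.smul_mk, h4]; rw [smul_comm]

/-- The graph is single-valued: the derivative of an element of `W¹₂[0, b]` is unique. -/
lemma graphL_single_valued (b : ℝ) (σ : L2 b) (p : L2 b × L2 b) (hp : p ∈ graphL b σ)
    (h0 : p.1 = 0) : p.2 = 0 := by
  obtain ⟨Y, g, h1, h2, -, h4⟩ := hp
  rw [h4]
  suffices hg : g = 0 by simp [hg]
  rcases le_or_gt b 0 with hb | hb
  · refine Lp.ext ?_
    simp [vol, Set.Ioo_eq_empty_of_le hb, Filter.EventuallyEq]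
  have hbI : b ∈ Set.Icc 0 b := ⟨hb.le, le_rfl⟩
  have hint := L2.intervalIntegrable g hbI
  have hcont : ContinuousOn Y (Set.Icc 0 b) := by
    have hc := intervalIntegral.continuousOn_primitive_interval' hint Set.left_mem_uIcc
    rw [Set.uIcc_of_le hb.le] at hc
    exact (continuousOn_const.add hc).congr h2
  have hY : Y =ᵐ[vol b] 0 := by
    rw [h0] at h1
    exact h1.symm.trans (Lp.coeFn_zero _ _ _)
  have hY0 : Set.EqOn Y 0 (Set.Ioo 0 b) :=
    Measure.eqOn_Ioo_of_ae_eq volume hY (hcont.mono Set.Ioo_subset_Icc_self) continuousOn_const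
  refine Lp.ext ?_
  have hd := hint.ae_hasDerivAt_integral
  filter_upwards [Lp.coeFn_zero ℂ 2 (vol b), ae_restrict_of_ae hd,
    ae_restrict_mem measurableSet_Ioo] with x hz hx hxI
  rw [hz]
  have hx' := hx (by rw [Set.uIcc_of_le hb.le]; exact Set.Ioo_subset_Icc_self hxI) 0
    Set.left_mem_uIcc
  have hc : (fun u => ∫ t in (0 : ℝ)..u, g t) =ᶠ[𝓝 x] fun _ => -Y 0 := by
    filter_upwards [isOpen_Ioo.mem_nhds hxI] with u hu
    have := h2 u (Set.Ioo_subset_Icc_self hu)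
    rw [hY0 hu] at this
    simp only [Pi.zero_apply] at this
    linear_combination -this
  exact hx'.unique ((hasDerivAt_const x (-Y 0)).congr_of_eventuallyEq hc)

/-- The operator `L y = -i y'` in `L₂(0, b)` with domain `{y ∈ W¹₂[0, b] : U(y) = 0}`. -/
def opL (b : ℝ) (σ : L2 b) : L2 b →ₗ.[ℂ] L2 b := (graphL b σ).toLinearPMap

/-- The spectrum of an operator `T` with domain in a Hilbert space `H`: the complement of the set
of those `z` for which `T - z` has a bounded inverse defined on all of `H`. -/
def spectrumSet {H : Type*} [NormedAddCommGroup H] [InnerProductSpace ℂ H] (T : H →ₗ.[ℂ] H) :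
    Set ℂ :=
  {z | ∃ R : H →L[ℂ] H,
    (∀ f : H, ∃ hf : R f ∈ T.domain, T ⟨R f, hf⟩ - z • R f = f) ∧
    (∀ y : T.domain, R (T y - z • (y : H)) = y)}ᶜ

/-- The entire function `Δ(z) = 1 - z ∫₀ᵇ exp(i z x) conj (σ x) dx`. -/
def charFn (b : ℝ) (σ : L2 b) (z : ℂ) : ℂ :=
  1 - z * ∫ x, Complex.exp (Complex.I * z * x) * starRingEnd ℂ (σ x) ∂(vol b)

/-- The multiplicity of `z` as a zero of `Δ`. -/
def mult (b : ℝ) (σ : L2 b) (z : ℂ) : ℕ := analyticOrderNatAt (charFn b σ) z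

/-- The function `w ↦ (w - z) ^ m / Δ(w)`, `m` the multiplicity of the zero `z` of `Δ`, with its
removable singularity at `w = z` removed. -/
def quot (b : ℝ) (σ : L2 b) (z : ℂ) : ℂ → ℂ :=
  let q : ℂ → ℂ := fun w => (w - z) ^ mult b σ z / charFn b σ w
  Function.update q z (limUnder (𝓝[≠] z) q)

/-- `d j`, the `j`-th derivative at `z` of `quot`; its Taylor coefficients are `d j / j!`. -/
def dCoef (b : ℝ) (σ : L2 b) (z : ℂ) (j : ℕ) : ℂ := iteratedDeriv j (quot b σ z) z

/-- The exponential monomial `(i t) ^ k / k! * exp(i z t)`. -/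
def expMon (k : ℕ) (z : ℂ) (t : ℝ) : ℂ :=
  (Complex.I * t) ^ k / (k.factorial : ℂ) * Complex.exp (Complex.I * z * t)

/-- The root function `u_k(x) = ∑_{j ≤ k} d_j / j! * (i x) ^ (k - j) / (k - j)! * exp(i z x)`. -/
def rootFn (b : ℝ) (σ : L2 b) (z : ℂ) (k : ℕ) (x : ℝ) : ℂ :=
  ∑ j ∈ Finset.range (k + 1), dCoef b σ z j / (j.factorial : ℂ) * expMon (k - j) z x

lemma memLp_rootFn (b : ℝ) (σ : L2 b) (z : ℂ) (k : ℕ) : MemLp (rootFn b σ z k) 2 (vol b) := by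
  have hc : Continuous (rootFn b σ z k) := by
    unfold rootFn expMon; fun_prop
  obtain ⟨C, hC⟩ := (isCompact_Icc (a := (0 : ℝ)) (b := b)).exists_bound_of_continuousOn
    hc.continuousOn
  refine MemLp.of_bound hc.aestronglyMeasurable C ?_
  filter_upwards [ae_restrict_mem measurableSet_Ioo] with x hx
  exact hC x (Set.Ioo_subset_Icc_self hx)

/-- The root function as an element of `L₂(0, b)`. -/
def rootVec (b : ℝ) (σ : L2 b) (z : ℂ) (k : ℕ) : L2 b := (memLp_rootFn b σ z k).toLp

/-- The indices `(z, k)`: `z` in the spectrum of `L` and `0 ≤ k ≤ m - 1`. -/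
abbrev RootIndex (b : ℝ) (σ : L2 b) : Type :=
  Σ z : spectrumSet (opL b σ), Fin (mult b σ z)

/-- The system of root functions. -/
def rootSystem (b : ℝ) (σ : L2 b) (i : RootIndex b σ) : L2 b := rootVec b σ i.1 i.2

/-- With `e(t) = (i t) ^ k / k! * exp(i z t)`, the function
`h_k(ξ) = conj (σ ξ) e(0) + ∫_ξ^b conj (σ μ) ∂_μ (e (μ - ξ)) dμ`.
The first term, which is `0` for `k ≥ 1` and `conj (σ ξ)` for `k = 0`, is the contribution of the
jump at `μ = ξ` of the truncated kernel, equal to `e (μ - ξ)` for `ξ ≤ μ` and to `0` for `μ < ξ`. -/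
def hFn (b : ℝ) (σ : L2 b) (z : ℂ) (k : ℕ) (ξ : ℝ) : ℂ :=
  starRingEnd ℂ (σ ξ) * expMon k z 0 +
    ∫ μ in ξ..b, starRingEnd ℂ (σ μ) * deriv (fun s : ℝ => expMon k z (s - ξ)) μ

/-- A family of vectors is minimal: none of them lies in the closed linear span of the others. -/
def IsMinimalSystem {H ι : Type*} [NormedAddCommGroup H] [InnerProductSpace ℂ H] (v : ι → H) :
    Prop :=
  ∀ i, v i ∉ (Submodule.span ℂ (v '' {i}ᶜ)).topologicalClosure

/-- The family `w` is biorthogonal to the family `v`: `(v j, w i) = δ_{ij}`. Mathlib's inner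
product is conjugate linear in its first argument. -/
def IsBiorthogonal {H ι : Type*} [NormedAddCommGroup H] [InnerProductSpace ℂ H] (v w : ι → H) :
    Prop :=
  (∀ i, inner ℂ (w i) (v i) = 1) ∧ ∀ i j, i ≠ j → inner ℂ (w i) (v j) = 0

end

end FirstOrderBVP

/-! Let U be the boundary form. Since U(exp(iwx)) = Δ(w), expanding at w = z + ε turns identities
between the functions `expMon k z` into identities between power series in ε. The root functions u_k
are the coefficients of ε^m exp(i(z+ε)x) / Δ(z+ε), so U(u_k) is the coefficient of ε^k in ε^m,
namely δ_{k,m} (`rootFn_zero_sub_pairing`). Thus u_k lies in D(L) for k < m, while U(u_m) = 1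
supplies the normalisation.

Biorthogonality rests on an adjoint relation obtained by integration by parts (`hPairing_deriv`):
∫(-iY' - zY) h_k = ∫ Y h_{k-1} + Y(0) c_k - δ_{k,0} U(Y), where c_k is the k-th Taylor coefficient
of Δ at z, zero for k < m. For Y = u_s at a point z' of multiplicity m' this becomes, with u_{-1} =
h_{-1} = 0, (z' - z)⟨u_s, h_k⟩ + ⟨u_{s-1}, h_k⟩ = ⟨u_s, h_{k-1}⟩ - δ_{k,0} δ_{s,m'}. If z' ≠ z,
double induction gives 0 for s < m'. If z' = z, the relation moves an index from h to u until u_m is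
met, giving -δ_{s+k+1,m}. Minimality follows by continuity of the dual functionals. -/

namespace FirstOrderBVP

noncomputable section

/-! ### Index shifts, exponential monomials and root functions -/

/-- The sequence `f` delayed by one step, starting with `0`. -/
def delay (f : ℕ → ℂ) : ℕ → ℂ
  | 0 => 0
  | k + 1 => f k

@[simp] lemma delay_zero (f : ℕ → ℂ) : delay f 0 = 0 := rfl

@[simp] lemma delay_succ (f : ℕ → ℂ) (k : ℕ) : delay f (k + 1) = f k := rfl

/-- In generating functions `delay` is multiplication by ε, which commutes with multiplication by a
fixed series. -/
lemma sum_mul_delay (q f : ℕ → ℂ) (k : ℕ) :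
    ∑ j ∈ Finset.range (k + 1), q j * delay f (k - j) =
      delay (fun n => ∑ j ∈ Finset.range (n + 1), q j * f (n - j)) k := by
  cases k with
  | zero => simp
  | succ k =>
    rw [Finset.sum_range_succ]
    simp only [Nat.sub_self, delay_zero, mul_zero, add_zero, delay_succ]
    refine Finset.sum_congr rfl fun j hj => ?_
    rw [Nat.succ_sub (Nat.lt_succ_iff.1 (Finset.mem_range.1 hj)), delay_succ]

@[fun_prop]
lemma continuous_expMon (k : ℕ) (z : ℂ) : Continuous (expMon k z) := by
  unfold expMon; fun_prop

lemma expMon_at_zero (k : ℕ) (z : ℂ) : expMon k z 0 = if k = 0 then 1 else 0 := by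
  cases k <;> simp [expMon]

lemma continuous_delay {f : ℕ → ℝ → ℂ} (hf : ∀ k, Continuous (f k)) (k : ℕ) :
    Continuous fun t => delay (fun j => f j t) k := by
  cases k with
  | zero => exact continuous_const
  | succ k => exact hf k

/-- Coefficient of ε^k in d/dt exp(i(z+ε)t) = i(z+ε) exp(i(z+ε)t). -/
lemma hasDerivAt_expMon (k : ℕ) (z : ℂ) (t : ℝ) :
    HasDerivAt (expMon k z)
      (Complex.I * (z * expMon k z t + delay (fun j => expMon j z t) k)) t := by
  have h1 : HasDerivAt (fun t : ℝ => Complex.exp (Complex.I * z * t))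
      (Complex.exp (Complex.I * z * t) * (Complex.I * z)) t := by
    simpa using (((hasDerivAt_id (t : ℂ)).const_mul (Complex.I * z)).cexp).comp_ofReal
  cases k with
  | zero =>
    convert h1 using 1
    · funext s; simp [expMon]
    · simp [expMon]; ring
  | succ k =>
    have h2 : HasDerivAt (fun t : ℝ => (Complex.I * (t : ℂ)) ^ (k + 1) / ((k + 1).factorial : ℂ))
        (((k + 1 : ℕ) : ℂ) * (Complex.I * t) ^ k * Complex.I / ((k + 1).factorial : ℂ)) t := by
      have := ((((hasDerivAt_id (t : ℂ)).const_mul Complex.I).pow (k + 1)).div_const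
        ((k + 1).factorial : ℂ)).comp_ofReal
      simpa using this
    refine (h2.mul h1).congr_deriv ?_
    have h3 : (k.factorial : ℂ) ≠ 0 := by exact_mod_cast k.factorial_ne_zero
    have h4 : (k : ℂ) + 1 ≠ 0 := by exact_mod_cast k.succ_ne_zero
    simp only [expMon, delay_succ, Nat.factorial_succ]
    push_cast
    field_simp
    ring

@[fun_prop]
lemma continuous_rootFn (b : ℝ) (σ : L2 b) (z : ℂ) (k : ℕ) : Continuous (rootFn b σ z k) := by
  unfold rootFn expMon; fun_prop

lemma hasDerivAt_rootFn (b : ℝ) (σ : L2 b) (z : ℂ) (k : ℕ) (t : ℝ) :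
    HasDerivAt (rootFn b σ z k)
      (Complex.I * (z * rootFn b σ z k t + delay (fun j => rootFn b σ z j t) k)) t := by
  have h : HasDerivAt (rootFn b σ z k) (∑ j ∈ Finset.range (k + 1),
      dCoef b σ z j / (j.factorial : ℂ) * (Complex.I * (z * expMon (k - j) z t +
        delay (fun i => expMon i z t) (k - j)))) t := by
    unfold rootFn
    exact HasDerivAt.fun_sum fun j _ => (hasDerivAt_expMon _ _ _).const_mul _
  refine h.congr_deriv ?_
  unfold rootFn
  rw [← sum_mul_delay (fun j => dCoef b σ z j / (j.factorial : ℂ)) (fun j => expMon j z t),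
    Finset.mul_sum, ← Finset.sum_add_distrib, Finset.mul_sum]
  exact Finset.sum_congr rfl fun j _ => by ring

/-! ### Pairing with conj σ -/

lemma integrable_mul_conj {b : ℝ} (σ : L2 b) {f : ℝ → ℂ} (hf : Continuous f) :
    Integrable (fun x => f x * starRingEnd ℂ (σ x)) (vol b) := by
  obtain ⟨C, hC⟩ := (isCompact_Icc (a := (0 : ℝ)) (b := b)).exists_bound_of_continuousOn
    hf.continuousOn
  have hσ : Integrable (fun x => starRingEnd ℂ (σ x)) (vol b) := by
    rw [← integrable_norm_iff]
    · simpa using (L2.integrable σ).norm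
    · exact Complex.continuous_conj.comp_aestronglyMeasurable (L2.integrable σ).1
  refine hσ.bdd_mul (c := C) hf.aestronglyMeasurable ?_
  filter_upwards [ae_restrict_mem measurableSet_Ioo] with x hx
  exact hC x (Set.Ioo_subset_Icc_self hx)

/-- The pairing `∫₀ᵇ f(x) conj (σ x) dx`. -/
def pairing (b : ℝ) (σ : L2 b) (f : ℝ → ℂ) : ℂ := ∫ x, f x * starRingEnd ℂ (σ x) ∂(vol b)

lemma pairing_add {b : ℝ} (σ : L2 b) {f g : ℝ → ℂ} (hf : Continuous f) (hg : Continuous g) :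
    pairing b σ (fun x => f x + g x) = pairing b σ f + pairing b σ g := by
  unfold pairing
  rw [← integral_add (integrable_mul_conj σ hf) (integrable_mul_conj σ hg)]
  simp only [add_mul]

lemma pairing_const_mul {b : ℝ} (σ : L2 b) (c : ℂ) (f : ℝ → ℂ) :
    pairing b σ (fun x => c * f x) = c * pairing b σ f := by
  unfold pairing
  rw [← integral_const_mul]
  simp only [mul_assoc]

lemma pairing_delay {b : ℝ} (σ : L2 b) (f : ℕ → ℝ → ℂ) (k : ℕ) :
    pairing b σ (fun x => delay (fun j => f j x) k) = delay (fun j => pairing b σ (f j)) k := by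
  cases k with
  | zero => simp [pairing]
  | succ k => rfl

lemma pairing_sum {b : ℝ} (σ : L2 b) {ι : Type*} (s : Finset ι) (c : ι → ℂ) {f : ι → ℝ → ℂ}
    (hf : ∀ i, Continuous (f i)) :
    pairing b σ (fun x => ∑ i ∈ s, c i * f i x) = ∑ i ∈ s, c i * pairing b σ (f i) := by
  simp_rw [← pairing_const_mul]
  unfold pairing
  rw [← integral_finsetSum s fun i _ => integrable_mul_conj σ
    (by fun_prop : Continuous fun x => c i * f i x)]
  simp only [Finset.sum_mul]

/-! ### Taylor expansion of Δ -/

lemma hasDerivAt_expMon_param (k : ℕ) (z : ℂ) (t : ℝ) :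
    HasDerivAt (fun w => expMon k w t) ((k + 1 : ℂ) * expMon (k + 1) z t) z := by
  have h1 : HasDerivAt (fun w : ℂ => Complex.exp (Complex.I * w * t))
      (Complex.exp (Complex.I * z * t) * (Complex.I * t)) z := by
    simpa using (((hasDerivAt_id z).const_mul Complex.I).mul_const (t : ℂ)).cexp
  refine (h1.const_mul ((Complex.I * t) ^ k / (k.factorial : ℂ))).congr_deriv ?_
  have h3 : (k.factorial : ℂ) ≠ 0 := by exact_mod_cast k.factorial_ne_zero
  have h4 : (k : ℂ) + 1 ≠ 0 := by exact_mod_cast k.succ_ne_zero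
  simp only [expMon, Nat.factorial_succ]
  push_cast
  field_simp
  ring

/-- Differentiation under the integral sign: for parameters in the unit ball around `z`, the
derivative of the integrand is dominated by a multiple of ‖σ‖. -/
lemma hasDerivAt_pairing_expMon {b : ℝ} (σ : L2 b) (k : ℕ) (z : ℂ) :
    HasDerivAt (fun w => pairing b σ (expMon k w))
      ((k + 1 : ℂ) * pairing b σ (expMon (k + 1) z)) z := by
  have hcont : Continuous fun p : ℂ × ℝ => (k + 1 : ℂ) * expMon (k + 1) p.1 p.2 := by
    unfold expMon; fun_prop
  obtain ⟨C, hC⟩ := ((isCompact_closedBall z 1).prod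
    (isCompact_Icc (a := (0 : ℝ)) (b := b))).exists_bound_of_continuousOn hcont.continuousOn
  rw [← pairing_const_mul]
  have hb := (L2.integrable σ).norm.const_mul C
  refine (hasDerivAt_integral_of_dominated_loc_of_deriv_le
    (bound := fun x => C * ‖σ x‖) (F := fun w x => expMon k w x * starRingEnd ℂ (σ x))
    (F' := fun w x => (k + 1 : ℂ) * expMon (k + 1) w x * starRingEnd ℂ (σ x))
    (Metric.closedBall_mem_nhds z one_pos)
    (Eventually.of_forall fun w => (integrable_mul_conj σ (continuous_expMon k w)).1)
    (integrable_mul_conj σ (continuous_expMon k z))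
    (integrable_mul_conj σ (continuous_const.mul (continuous_expMon (k + 1) z))).1 ?_ hb ?_).2
  · filter_upwards [ae_restrict_mem measurableSet_Ioo] with x hx w hw
    rw [norm_mul, RCLike.norm_conj]
    exact mul_le_mul_of_nonneg_right (hC (w, x) ⟨hw, Set.Ioo_subset_Icc_self hx⟩) (norm_nonneg _)
  · exact Eventually.of_forall fun x w _ => (hasDerivAt_expMon_param k w x).mul_const _

lemma charFn_eq (b : ℝ) (σ : L2 b) (z : ℂ) : charFn b σ z = 1 - z * pairing b σ (expMon 0 z) := by
  simp [charFn, pairing, expMon]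

/-- The Taylor coefficients of `Δ`. -/
def charCoef (b : ℝ) (σ : L2 b) (z : ℂ) (n : ℕ) : ℂ :=
  expMon n z 0 - (z * pairing b σ (expMon n z) + delay (fun j => pairing b σ (expMon j z)) n)

lemma hasDerivAt_charCoef (b : ℝ) (σ : L2 b) (z : ℂ) (n : ℕ) :
    HasDerivAt (fun w => charCoef b σ w n) ((n + 1 : ℂ) * charCoef b σ z (n + 1)) z := by
  have h0 : HasDerivAt (fun w => expMon n w 0) 0 z := by
    simp_rw [expMon_at_zero]; exact hasDerivAt_const _ _
  have h1 := (hasDerivAt_id z).mul (hasDerivAt_pairing_expMon σ n z)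
  cases n with
  | zero =>
    -- The constant 0 is the `delay` term of `charCoef` at index 0.
    refine (h0.sub (h1.add_const 0)).congr_deriv ?_
    simp [charCoef, expMon_at_zero]
    ring
  | succ n =>
    refine (h0.sub (h1.add (hasDerivAt_pairing_expMon σ n z))).congr_deriv ?_
    simp [charCoef, expMon_at_zero]
    ring

lemma iteratedDeriv_charFn (b : ℝ) (σ : L2 b) (n : ℕ) (z : ℂ) :
    iteratedDeriv n (charFn b σ) z = n.factorial * charCoef b σ z n := by
  induction n generalizing z with
  | zero => simp [charCoef, charFn_eq, expMon_at_zero]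
  | succ n ih =>
    rw [iteratedDeriv_succ, funext ih,
      ((hasDerivAt_charCoef b σ z n).const_mul (n.factorial : ℂ)).deriv, Nat.factorial_succ]
    push_cast
    ring

lemma analyticAt_charFn (b : ℝ) (σ : L2 b) (z : ℂ) : AnalyticAt ℂ (charFn b σ) z := by
  refine Differentiable.analyticAt (fun w => ?_) z
  have h : charFn b σ = fun w => charCoef b σ w 0 := by
    funext w; simp [charCoef, charFn_eq, expMon_at_zero]
  rw [h]
  exact (hasDerivAt_charCoef b σ w 0).differentiableAt

/-- By the identity theorem, because Δ(0) = 1. Hence `mult` is the true order of vanishing, not the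
default value for infinite order. -/
lemma analyticOrderAt_charFn_ne_top (b : ℝ) (σ : L2 b) (z : ℂ) :
    analyticOrderAt (charFn b σ) z ≠ ⊤ := by
  intro h
  rw [analyticOrderAt_eq_top] at h
  have h1 := AnalyticOnNhd.eqOn_of_preconnected_of_eventuallyEq (g := 0)
    (fun w _ => analyticAt_charFn b σ w) (fun w _ => analyticAt_const) isPreconnected_univ
    (Set.mem_univ z) h (Set.mem_univ 0)
  simp [charFn] at h1

/-- Once Δ = (w - z)^m g with g(z) ≠ 0, the quotient is 1/g off `z`, and the limit defining its
value at `z` is 1/g(z). -/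
lemma exists_quot_eq_inv (b : ℝ) (σ : L2 b) (z : ℂ) :
    ∃ g : ℂ → ℂ, AnalyticAt ℂ g z ∧ g z ≠ 0 ∧
      (∀ᶠ w in 𝓝 z, charFn b σ w = (w - z) ^ mult b σ z * g w) ∧
      quot b σ z =ᶠ[𝓝 z] fun w => (g w)⁻¹ := by
  obtain ⟨g, hg, hgz, hfac⟩ := (analyticAt_charFn b σ z).analyticOrderAt_eq_natCast.1
    (Nat.cast_analyticOrderNatAt (analyticOrderAt_charFn_ne_top b σ z)).symm
  have hne : ∀ᶠ w in 𝓝 z, g w ≠ 0 := hg.continuousAt.eventually_ne hgz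
  have hpun : (fun w => (w - z) ^ mult b σ z / charFn b σ w) =ᶠ[𝓝[≠] z] fun w => (g w)⁻¹ := by
    filter_upwards [hfac.filter_mono nhdsWithin_le_nhds, hne.filter_mono nhdsWithin_le_nhds,
      self_mem_nhdsWithin] with w h1 h2 h3
    have h4 : (w - z) ^ mult b σ z ≠ 0 := pow_ne_zero _ (sub_ne_zero.2 h3)
    change _ / charFn b σ w = _
    rw [h1, smul_eq_mul]
    change _ / ((w - z) ^ mult b σ z * g w) = _
    field_simp
  have hlim : limUnder (𝓝[≠] z) (fun w => (w - z) ^ mult b σ z / charFn b σ w) = (g z)⁻¹ :=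
    (((hg.continuousAt.inv₀ hgz).tendsto.mono_left nhdsWithin_le_nhds).congr' hpun.symm).limUnder_eq
  refine ⟨g, hg, hgz, hfac, ?_⟩
  filter_upwards [eventually_nhdsWithin_iff.1 hpun] with w hw
  by_cases hwz : w = z
  · subst hwz
    simp only [quot, Function.update_self]
    exact hlim
  · simp only [quot, Function.update_of_ne hwz]
    exact hw hwz

/-- Leibniz rule at `z` for the product of `quot` and Δ, which is (w - z)^m near `z`. -/
lemma sum_dCoef_mul_charCoef (b : ℝ) (σ : L2 b) (z : ℂ) (n : ℕ) :
    ∑ j ∈ Finset.range (n + 1), dCoef b σ z j / (j.factorial : ℂ) * charCoef b σ z (n - j) =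
      if n = mult b σ z then 1 else 0 := by
  obtain ⟨g, hg, hgz, hfac, hq⟩ := exists_quot_eq_inv b σ z
  have hqa : AnalyticAt ℂ (quot b σ z) z := (hg.inv hgz).congr hq.symm
  have hprod : (fun w => quot b σ z w * charFn b σ w) =ᶠ[𝓝 z] fun w => (w - z) ^ mult b σ z := by
    filter_upwards [hfac, hq, hg.continuousAt.eventually_ne hgz] with w h1 h2 h3
    rw [h1, h2]
    field_simp
  have h := hprod.iteratedDeriv_eq n
  rw [iteratedDeriv_fun_mul hqa.contDiffAt (analyticAt_charFn b σ z).contDiffAt,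
    congrFun (iteratedDeriv_comp_sub_const n (fun w => w ^ mult b σ z) z) z, sub_self,
    iteratedDeriv_fun_pow_zero] at h
  have hn : (n.factorial : ℂ) ≠ 0 := by exact_mod_cast n.factorial_ne_zero
  apply mul_left_cancel₀ hn
  have : (n.factorial : ℂ) * (if n = mult b σ z then 1 else 0) =
      if n = mult b σ z then (n.factorial : ℂ) else 0 := by split_ifs <;> simp
  rw [this, Finset.mul_sum]
  refine Eq.trans (Finset.sum_congr rfl fun j hj => ?_) (h.trans ?_)
  · have hj' : j ≤ n := Nat.lt_succ_iff.1 (Finset.mem_range.1 hj)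
    rw [iteratedDeriv_charFn, ← Nat.choose_mul_factorial_mul_factorial hj']
    have : (j.factorial : ℂ) ≠ 0 := by exact_mod_cast j.factorial_ne_zero
    simp only [dCoef]
    push_cast
    field_simp
  · split_ifs <;> simp_all

lemma charCoef_eq_zero {b : ℝ} {σ : L2 b} {z : ℂ} {n : ℕ} (hn : n < mult b σ z) :
    charCoef b σ z n = 0 := by
  have hn0 : (n.factorial : ℂ) ≠ 0 := by exact_mod_cast n.factorial_ne_zero
  obtain ⟨g, hg, -, hfac, -⟩ := exists_quot_eq_inv b σ z
  have h := iteratedDeriv_charFn b σ n z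
  rw [EventuallyEq.iteratedDeriv_eq n hfac, iteratedDeriv_fun_mul
      ((by fun_prop : ContDiff ℂ n fun w : ℂ => (w - z) ^ mult b σ z).contDiffAt) hg.contDiffAt,
    Finset.sum_eq_zero] at h
  · exact (mul_eq_zero.1 h.symm).resolve_left hn0
  · intro j hj
    have : j ≠ mult b σ z := by have := Finset.mem_range.1 hj; omega
    rw [congrFun (iteratedDeriv_comp_sub_const j (fun w => w ^ mult b σ z) z) z, sub_self,
      iteratedDeriv_fun_pow_zero, if_neg (by omega)]
    simp

/-- `U(u_k)` vanishes unless `k` is the multiplicity `m` of `z`, where it is `1`. -/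
lemma rootFn_zero_sub_pairing (b : ℝ) (σ : L2 b) (z : ℂ) (k : ℕ) :
    rootFn b σ z k 0 - pairing b σ
        (fun x => z * rootFn b σ z k x + delay (fun j => rootFn b σ z j x) k) =
      if k = mult b σ z then 1 else 0 := by
  -- `charCoef` is U applied to `expMon`, so by linearity U(u_k) is the convolution of the
  -- coefficients of `quot` and of Δ.
  rw [← sum_dCoef_mul_charCoef, pairing_add σ
    (by fun_prop : Continuous fun x => z * rootFn b σ z k x)
    (continuous_delay (continuous_rootFn b σ z) k), pairing_const_mul, pairing_delay]
  have h : ∀ j, pairing b σ (rootFn b σ z j) = ∑ i ∈ Finset.range (j + 1),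
      dCoef b σ z i / (i.factorial : ℂ) * pairing b σ (expMon (j - i) z) := fun j =>
    pairing_sum σ _ _ fun i => continuous_expMon (j - i) z
  simp_rw [h]
  rw [← sum_mul_delay (fun j => dCoef b σ z j / (j.factorial : ℂ))
      (fun j => pairing b σ (expMon j z)), Finset.mul_sum, ← Finset.sum_add_distrib]
  unfold rootFn charCoef
  rw [← Finset.sum_sub_distrib]
  exact Finset.sum_congr rfl fun j _ => by ring

/-! ### Convolutions and Fubini on the triangle ξ < μ -/

/-- The convolution `∫₀^μ f(ξ) g(μ - ξ) dξ`. -/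
def volterra (f g : ℝ → ℂ) (μ : ℝ) : ℂ := ∫ ξ in (0 : ℝ)..μ, f ξ * g (μ - ξ)

@[fun_prop]
lemma continuous_volterra {f g : ℝ → ℂ} (hf : Continuous f) (hg : Continuous g) :
    Continuous (volterra f g) :=
  intervalIntegral.continuous_parametric_intervalIntegral_of_continuous
    (f := fun μ ξ => f ξ * g (μ - ξ)) (by fun_prop) continuous_id

lemma volterra_lin_left {f f' g : ℝ → ℂ} (hf : Continuous f) (hf' : Continuous f')
    (hg : Continuous g) (a a' : ℂ) (μ : ℝ) :
    volterra (fun x => a * f x + a' * f' x) g μ = a * volterra f g μ + a' * volterra f' g μ := by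
  unfold volterra
  rw [← intervalIntegral.integral_const_mul, ← intervalIntegral.integral_const_mul,
    ← intervalIntegral.integral_add (Continuous.intervalIntegrable (by fun_prop) _ _)
      (Continuous.intervalIntegrable (by fun_prop) _ _)]
  congr 1; funext x; ring

lemma volterra_lin_right {f g g' : ℝ → ℂ} (hf : Continuous f) (hg : Continuous g)
    (hg' : Continuous g') (a a' : ℂ) (μ : ℝ) :
    volterra f (fun x => a * g x + a' * g' x) μ = a * volterra f g μ + a' * volterra f g' μ := by
  unfold volterra
  rw [← intervalIntegral.integral_const_mul, ← intervalIntegral.integral_const_mul,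
    ← intervalIntegral.integral_add (Continuous.intervalIntegrable (by fun_prop) _ _)
      (Continuous.intervalIntegrable (by fun_prop) _ _)]
  congr 1; funext x; ring

/-- Integration by parts; the boundary term at ξ = μ matches the jump term of `hFn`. -/
lemma volterra_deriv {Y Y' g g' : ℝ → ℂ} (hY : ∀ t, HasDerivAt Y (Y' t) t)
    (hY' : Continuous Y') (hg : ∀ t, HasDerivAt g (g' t) t) (hg' : Continuous g') (μ : ℝ) :
    volterra Y' g μ = Y μ * g 0 - Y 0 * g μ + volterra Y g' μ := by
  have hgc : Continuous g := continuous_iff_continuousAt.2 fun t => (hg t).continuousAt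
  have hd : ∀ ξ, HasDerivAt (fun ξ => g (μ - ξ)) (-g' (μ - ξ)) ξ := fun ξ =>
    (hg (μ - ξ)).comp_const_sub μ ξ
  have h := intervalIntegral.integral_mul_deriv_eq_deriv_mul (a := 0) (b := μ)
    (fun x _ => hY x) (fun x _ => hd x) (hY'.intervalIntegrable _ _)
    (Continuous.intervalIntegrable (by fun_prop) _ _)
  simp only [mul_neg, intervalIntegral.integral_neg, sub_self, sub_zero] at h
  unfold volterra
  linear_combination h

/-- The integrand `f(ξ) conj (σ μ) K(μ - ξ)`, truncated to `ξ < μ`. -/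
def truncKernel {b : ℝ} (σ : L2 b) (f K : ℝ → ℂ) (p : ℝ × ℝ) : ℂ :=
  Set.indicator {q : ℝ × ℝ | q.1 < q.2}
    (fun q => f q.1 * K (q.2 - q.1) * starRingEnd ℂ (σ q.2)) p

lemma integrable_conj {b : ℝ} (σ : L2 b) : Integrable (fun x => starRingEnd ℂ (σ x)) (vol b) := by
  simpa using integrable_mul_conj σ (f := fun _ => 1) continuous_const

lemma exists_bound_kernel (b : ℝ) {f K : ℝ → ℂ} (hf : Continuous f) (hK : Continuous K) :
    ∃ C, ∀ x ∈ Set.Ioo 0 b, ∀ y ∈ Set.Ioo 0 b, ‖f x * K (y - x)‖ ≤ C := by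
  have hcont : Continuous fun p : ℝ × ℝ => f p.1 * K (p.2 - p.1) := by fun_prop
  obtain ⟨C, hC⟩ := ((isCompact_Icc (a := (0 : ℝ)) (b := b)).prod
    (isCompact_Icc (a := (0 : ℝ)) (b := b))).exists_bound_of_continuousOn hcont.continuousOn
  exact ⟨C, fun x hx y hy =>
    hC (x, y) ⟨Set.Ioo_subset_Icc_self hx, Set.Ioo_subset_Icc_self hy⟩⟩

lemma integrable_truncKernel {b : ℝ} (σ : L2 b) {f K : ℝ → ℂ} (hf : Continuous f)
    (hK : Continuous K) : Integrable (truncKernel σ f K) ((vol b).prod (vol b)) := by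
  obtain ⟨C, hC⟩ := exists_bound_kernel b hf hK
  have hcont : Continuous fun p : ℝ × ℝ => f p.1 * K (p.2 - p.1) := by fun_prop
  refine Integrable.indicator ?_ (measurableSet_lt measurable_fst measurable_snd)
  refine ((integrable_conj σ).comp_snd (vol b)).bdd_mul (c := C) hcont.aestronglyMeasurable ?_
  rw [Measure.prod_restrict]
  filter_upwards [ae_restrict_mem (measurableSet_Ioo.prod measurableSet_Ioo)] with p hp
  exact hC p.1 hp.1 p.2 hp.2

lemma integral_truncKernel_snd {b : ℝ} (σ : L2 b) (f K : ℝ → ℂ) {ξ : ℝ} (hξ : ξ ∈ Set.Ioo 0 b) :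
    ∫ μ, truncKernel σ f K (ξ, μ) ∂(vol b) =
      f ξ * ∫ μ in ξ..b, starRingEnd ℂ (σ μ) * K (μ - ξ) := by
  have h : ∀ μ, truncKernel σ f K (ξ, μ) = Set.indicator (Set.Ioi ξ)
      (fun μ => f ξ * (starRingEnd ℂ (σ μ) * K (μ - ξ))) μ := fun μ => by
    simp only [truncKernel, Set.indicator, Set.mem_ofPred_eq, Set.mem_Ioi]
    split_ifs <;> ring
  have hI : Set.Ioi ξ ∩ Set.Ioo 0 b = Set.Ioo ξ b := by
    ext x; simp only [Set.mem_inter_iff, Set.mem_Ioi, Set.mem_Ioo]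
    exact ⟨fun h => ⟨h.1, h.2.2⟩, fun h => ⟨h.1, hξ.1.trans h.1, h.2⟩⟩
  simp_rw [h]
  rw [integral_indicator measurableSet_Ioi, Measure.restrict_restrict measurableSet_Ioi, hI,
    intervalIntegral.integral_of_le hξ.2.le, integral_Ioc_eq_integral_Ioo, integral_const_mul]

lemma integral_truncKernel_fst {b : ℝ} (σ : L2 b) (f K : ℝ → ℂ) {μ : ℝ} (hμ : μ ∈ Set.Ioo 0 b) :
    ∫ ξ, truncKernel σ f K (ξ, μ) ∂(vol b) = volterra f K μ * starRingEnd ℂ (σ μ) := by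
  have h : ∀ ξ, truncKernel σ f K (ξ, μ) = Set.indicator (Set.Iio μ)
      (fun ξ => f ξ * K (μ - ξ) * starRingEnd ℂ (σ μ)) ξ := fun ξ => rfl
  have hI : Set.Iio μ ∩ Set.Ioo 0 b = Set.Ioo 0 μ := by
    ext x; simp only [Set.mem_inter_iff, Set.mem_Iio, Set.mem_Ioo]
    exact ⟨fun h => ⟨h.2.1, h.1⟩, fun h => ⟨h.2, h.1, h.2.trans hμ.2⟩⟩
  simp_rw [h]
  rw [integral_indicator measurableSet_Iio, Measure.restrict_restrict measurableSet_Iio, hI,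
    volterra, intervalIntegral.integral_of_le hμ.1.le, integral_Ioc_eq_integral_Ioo,
    integral_mul_const]

lemma integral_mul_tail {b : ℝ} (σ : L2 b) {f K : ℝ → ℂ} (hf : Continuous f)
    (hK : Continuous K) :
    ∫ ξ, f ξ * (∫ μ in ξ..b, starRingEnd ℂ (σ μ) * K (μ - ξ)) ∂(vol b) =
      pairing b σ (volterra f K) := by
  have h1 : (fun ξ => ∫ μ, truncKernel σ f K (ξ, μ) ∂(vol b)) =ᵐ[vol b]
      fun ξ => f ξ * ∫ μ in ξ..b, starRingEnd ℂ (σ μ) * K (μ - ξ) := by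
    filter_upwards [ae_restrict_mem measurableSet_Ioo] with ξ hξ
    exact integral_truncKernel_snd σ f K hξ
  have h2 : (fun μ => ∫ ξ, truncKernel σ f K (ξ, μ) ∂(vol b)) =ᵐ[vol b]
      fun μ => volterra f K μ * starRingEnd ℂ (σ μ) := by
    filter_upwards [ae_restrict_mem measurableSet_Ioo] with μ hμ
    exact integral_truncKernel_fst σ f K hμ
  rw [← integral_congr_ae h1, pairing, ← integral_congr_ae h2]
  exact integral_integral_swap (f := fun ξ μ => truncKernel σ f K (ξ, μ))
    (integrable_truncKernel σ hf hK)

/-- The tail is bounded, σ being integrable and `K` bounded on the relevant range. Its measurability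
in ξ comes from Fubini for the truncated kernel. -/
lemma memLp_tail {b : ℝ} (σ : L2 b) {K : ℝ → ℂ} (hK : Continuous K) :
    MemLp (fun ξ => ∫ μ in ξ..b, starRingEnd ℂ (σ μ) * K (μ - ξ)) 2 (vol b) := by
  obtain ⟨C, hC⟩ := exists_bound_kernel b (f := fun _ => 1) continuous_const hK
  have h1 : (fun ξ => ∫ μ, truncKernel σ (fun _ => 1) K (ξ, μ) ∂(vol b)) =ᵐ[vol b]
      fun ξ => ∫ μ in ξ..b, starRingEnd ℂ (σ μ) * K (μ - ξ) := by
    filter_upwards [ae_restrict_mem measurableSet_Ioo] with ξ hξ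
    rw [integral_truncKernel_snd σ _ K hξ, one_mul]
  refine MemLp.ae_eq h1 (MemLp.of_bound
    (integrable_truncKernel σ continuous_const hK).integral_prod_left.1
    (∫ μ, C * ‖σ μ‖ ∂(vol b)) ?_)
  filter_upwards [ae_restrict_mem measurableSet_Ioo] with ξ hξ
  refine norm_integral_le_of_norm_le ((L2.integrable σ).norm.const_mul C) ?_
  filter_upwards [ae_restrict_mem measurableSet_Ioo] with μ hμ
  refine (norm_indicator_le_norm_self _ _).trans ?_
  rw [norm_mul, RCLike.norm_conj]
  exact mul_le_mul_of_nonneg_right (hC ξ hξ μ hμ) (norm_nonneg _)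

/-! ### The functions h_k and the adjoint relation -/

/-- The derivative of `expMon k z`. -/
def expMonDeriv (z : ℂ) (k : ℕ) (t : ℝ) : ℂ :=
  (Complex.I * z) * expMon k z t + Complex.I * delay (fun j => expMon j z t) k

lemma hasDerivAt_expMon' (k : ℕ) (z : ℂ) (t : ℝ) :
    HasDerivAt (expMon k z) (expMonDeriv z k t) t :=
  (hasDerivAt_expMon k z t).congr_deriv (by unfold expMonDeriv; ring)

@[fun_prop]
lemma continuous_expMonDeriv (z : ℂ) (k : ℕ) : Continuous (expMonDeriv z k) := by
  have := continuous_delay (fun j => continuous_expMon j z) k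
  unfold expMonDeriv; fun_prop

lemma hFn_eq (b : ℝ) (σ : L2 b) (z : ℂ) (k : ℕ) (ξ : ℝ) :
    hFn b σ z k ξ = starRingEnd ℂ (σ ξ) * expMon k z 0 +
      ∫ μ in ξ..b, starRingEnd ℂ (σ μ) * expMonDeriv z k (μ - ξ) := by
  have h : ∀ μ, deriv (fun s : ℝ => expMon k z (s - ξ)) μ = expMonDeriv z k (μ - ξ) := fun μ =>
    ((hasDerivAt_expMon' k z (μ - ξ)).comp_sub_const μ ξ).deriv
  simp only [hFn, h]

lemma memLp_hFn (b : ℝ) (σ : L2 b) (z : ℂ) (k : ℕ) : MemLp (hFn b σ z k) 2 (vol b) := by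
  rw [funext (hFn_eq b σ z k)]
  exact ((Lp.memLp σ).star.mul_const _).add (memLp_tail σ (continuous_expMonDeriv z k))

lemma integrable_mul_hFn (b : ℝ) (σ : L2 b) (z : ℂ) (k : ℕ) {f : ℝ → ℂ} (hf : Continuous f) :
    Integrable (fun ξ => f ξ * hFn b σ z k ξ) (vol b) := by
  obtain ⟨C, hC⟩ := (isCompact_Icc (a := (0 : ℝ)) (b := b)).exists_bound_of_continuousOn
    hf.continuousOn
  refine ((memLp_hFn b σ z k).integrable (by norm_num)).bdd_mul (c := C)
    hf.aestronglyMeasurable ?_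
  filter_upwards [ae_restrict_mem measurableSet_Ioo] with x hx
  exact hC x (Set.Ioo_subset_Icc_self hx)

/-- The pairing `∫₀ᵇ f(ξ) h_k(ξ) dξ`. -/
def hPairing (b : ℝ) (σ : L2 b) (z : ℂ) (k : ℕ) (f : ℝ → ℂ) : ℂ :=
  ∫ ξ, f ξ * hFn b σ z k ξ ∂(vol b)

lemma hPairing_lin (b : ℝ) (σ : L2 b) (z : ℂ) (k : ℕ) {f g : ℝ → ℂ} (hf : Continuous f)
    (hg : Continuous g) (a c : ℂ) :
    hPairing b σ z k (fun x => a * f x + c * g x) =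
      a * hPairing b σ z k f + c * hPairing b σ z k g := by
  unfold hPairing
  rw [← integral_const_mul, ← integral_const_mul, ← integral_add
    ((integrable_mul_hFn b σ z k hf).const_mul a) ((integrable_mul_hFn b σ z k hg).const_mul c)]
  congr 1; funext x; ring

/-- Fubini moves everything onto conj σ, so identities between pairings with h_k reduce to pointwise
identities in μ. -/
lemma hPairing_eq (b : ℝ) (σ : L2 b) (z : ℂ) (k : ℕ) {f : ℝ → ℂ} (hf : Continuous f) :
    hPairing b σ z k f =
      pairing b σ (fun μ => expMon k z 0 * f μ + volterra f (expMonDeriv z k) μ) := by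
  have hc := continuous_expMonDeriv z k
  have hfc : Continuous fun x => expMon k z 0 * f x := by fun_prop
  have hsub : Integrable (fun ξ => f ξ * ∫ μ in ξ..b,
      starRingEnd ℂ (σ μ) * expMonDeriv z k (μ - ξ)) (vol b) := by
    refine ((integrable_mul_hFn b σ z k hf).sub (integrable_mul_conj σ hfc)).congr
      (Eventually.of_forall fun ξ => ?_)
    simp only [Pi.sub_apply, hFn_eq]; ring
  rw [pairing_add σ hfc (continuous_volterra hf hc), ← integral_mul_tail σ hf hc, hPairing,
    pairing, ← integral_add (integrable_mul_conj σ hfc) hsub]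
  congr 1; funext ξ; rw [hFn_eq]; ring

/-- The formal adjoint relation between `-i d/dx - z` and the functions `h_k`. -/
lemma hPairing_deriv (b : ℝ) (σ : L2 b) (z : ℂ) (k : ℕ) {Y Y' : ℝ → ℂ}
    (hY : ∀ t, HasDerivAt Y (Y' t) t) (hY' : Continuous Y') :
    hPairing b σ z k (fun x => -Complex.I * Y' x + -z * Y x) =
      delay (fun j => hPairing b σ z j Y) k + Y 0 * charCoef b σ z k
        - expMon k z 0 * (Y 0 - pairing b σ (fun x => -Complex.I * Y' x)) := by
  have hYc : Continuous Y := continuous_iff_continuousAt.2 fun t => (hY t).continuousAt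
  have hK := continuous_expMonDeriv z k
  have hE := continuous_expMon k z
  have hD := continuous_delay (fun j => continuous_expMon j z) k
  have hT : ∀ j, Continuous fun μ => expMon j z 0 * Y μ + volterra Y (expMonDeriv z j) μ :=
    fun j => by fun_prop
  -- Integration by parts turns the lower-order part of the kernel derivative into the integrand
  -- belonging to h_{k-1}.
  have hdel : ∀ μ, volterra Y' (fun t => delay (fun j => expMon j z t) k) μ =
      delay (fun j => expMon j z 0 * Y μ + volterra Y (expMonDeriv z j) μ) k
        - Y 0 * delay (fun j => expMon j z μ) k := fun μ => by
    cases k with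
    | zero => simp [volterra]
    | succ k =>
      simp only [delay_succ]
      rw [volterra_deriv hY hY' (hasDerivAt_expMon' k z) (continuous_expMonDeriv z k)]
      ring
  -- The adjoint relation before pairing with conj σ: expanding the kernel derivative against `Y'`
  -- and integrating by parts cancels the terms coming from -zY.
  have key : ∀ μ, expMon k z 0 * (-Complex.I * Y' μ + -z * Y μ) +
      volterra (fun x => -Complex.I * Y' x + -z * Y x) (expMonDeriv z k) μ =
      (expMon k z 0 * (-Complex.I * Y' μ) + -Y 0 * (z * expMon k z μ
        + delay (fun j => expMon j z μ) k)) +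
      delay (fun j => expMon j z 0 * Y μ + volterra Y (expMonDeriv z j) μ) k := fun μ => by
    have e1 : volterra Y' (expMonDeriv z k) μ = (Complex.I * z) * volterra Y' (expMon k z) μ +
        Complex.I * volterra Y' (fun t => delay (fun j => expMon j z t) k) μ :=
      volterra_lin_right hY' hE hD _ _ μ
    rw [volterra_lin_left hY' hYc hK, e1, hdel,
      volterra_deriv hY hY' (hasDerivAt_expMon' k z) hK]
    linear_combination -(z * (Y μ * expMon k z 0 - Y 0 * expMon k z μ +
      volterra Y (expMonDeriv z k) μ) + delay (fun j => expMon j z 0 * Y μ +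
      volterra Y (expMonDeriv z j) μ) k - Y 0 * delay (fun j => expMon j z μ) k) * Complex.I_sq
  rw [hPairing_eq b σ z k (by fun_prop), funext key, pairing_add σ (by fun_prop)
    (continuous_delay hT k), pairing_add σ (by fun_prop) (by fun_prop), pairing_const_mul,
    pairing_const_mul, pairing_delay,
    pairing_const_mul σ (-Y 0) (fun μ => z * expMon k z μ + delay (fun j => expMon j z μ) k),
    pairing_add σ (by fun_prop) hD, pairing_const_mul, pairing_delay]
  simp_rw [hPairing_eq b σ z _ hYc]
  unfold charCoef
  ring

/-! ### Pairings of root functions with h_k -/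

/-- The adjoint relation for Y = u_s, where -iY' - zY = (z' - z)u_s + u_{s-1}; `hk` removes the
Taylor coefficient of Δ. The index `s` stays unrestricted because u_m, outside D(L), carries the
source term. -/
lemma hPairing_rootFn_rec (b : ℝ) (σ : L2 b) (z z' : ℂ) (s k : ℕ) (hk : k < mult b σ z) :
    (z' - z) * hPairing b σ z k (rootFn b σ z' s)
        + delay (fun j => hPairing b σ z k (rootFn b σ z' j)) s =
      delay (fun j => hPairing b σ z j (rootFn b σ z' s)) k
        - if k = 0 ∧ s = mult b σ z' then 1 else 0 := by
  have hd := continuous_delay (continuous_rootFn b σ z') s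
  have h := hPairing_deriv b σ z k (hasDerivAt_rootFn b σ z' s) (by fun_prop)
  have e : ∀ x, -Complex.I * (Complex.I * (z' * rootFn b σ z' s x
      + delay (fun j => rootFn b σ z' j x) s)) =
      z' * rootFn b σ z' s x + delay (fun j => rootFn b σ z' j x) s := fun x => by
    linear_combination -(z' * rootFn b σ z' s x + delay (fun j => rootFn b σ z' j x) s)
      * Complex.I_sq
  have e' : ∀ x, z' * rootFn b σ z' s x + delay (fun j => rootFn b σ z' j x) s
      + -z * rootFn b σ z' s x = (z' - z) * rootFn b σ z' s x
      + 1 * delay (fun j => rootFn b σ z' j x) s := fun x => by ring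
  have e'' : hPairing b σ z k (fun x => delay (fun j => rootFn b σ z' j x) s) =
      delay (fun j => hPairing b σ z k (rootFn b σ z' j)) s := by
    cases s with
    | zero => simp [hPairing]
    | succ s => rfl
  simp only [e, e', rootFn_zero_sub_pairing, charCoef_eq_zero hk, expMon_at_zero] at h
  rw [hPairing_lin b σ z k (continuous_rootFn b σ z' s) hd, e''] at h
  rw [one_mul] at h
  rw [h]
  split_ifs <;> simp_all

/-- Both neighbouring pairings in the recursion vanish by induction, the source term is absent for s
< m', and z' - z is invertible. -/
lemma hPairing_rootFn_of_ne {b : ℝ} {σ : L2 b} {z z' : ℂ} (hz : z' ≠ z) {s k : ℕ}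
    (hs : s < mult b σ z') (hk : k < mult b σ z) :
    hPairing b σ z k (rootFn b σ z' s) = 0 := by
  induction s generalizing k with
  | zero =>
    induction k with
    | zero =>
      have h := hPairing_rootFn_rec b σ z z' 0 0 hk
      simpa [hs.ne, sub_ne_zero.2 hz] using h
    | succ k ih =>
      have h := hPairing_rootFn_rec b σ z z' 0 (k + 1) hk
      simpa [ih (by omega), sub_ne_zero.2 hz] using h
  | succ s ihs =>
    induction k with
    | zero =>
      have h := hPairing_rootFn_rec b σ z z' (s + 1) 0 hk
      simpa [hs.ne, sub_ne_zero.2 hz, ihs (by omega) hk] using h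
    | succ k ih =>
      have h := hPairing_rootFn_rec b σ z z' (s + 1) (k + 1) hk
      simpa [ih (by omega), sub_ne_zero.2 hz, ihs (by omega) hk] using h

/-- With z' = z the recursion reads ⟨u_s, h_{k+1}⟩ = ⟨u_{s+1}, h_k⟩, preserving s + k; at k = 0 only
the source term remains. -/
lemma hPairing_rootFn_self {b : ℝ} {σ : L2 b} {z : ℂ} {s k : ℕ} (hk : k < mult b σ z) :
    hPairing b σ z k (rootFn b σ z s) = if s + k + 1 = mult b σ z then -1 else 0 := by
  induction k generalizing s with
  | zero =>
    -- Index s + 1 makes the delayed term u_s; the case s + 1 = m yields the -1.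
    have h := hPairing_rootFn_rec b σ z z (s + 1) 0 hk
    simp only [sub_self, zero_mul, zero_add, delay_succ, delay_zero, true_and, zero_sub] at h
    rw [h]
    simp only [add_zero]
    split_ifs <;> simp
  | succ k ih =>
    have h := hPairing_rootFn_rec b σ z z (s + 1) (k + 1) hk
    simp only [sub_self, zero_mul, zero_add, delay_succ, Nat.succ_ne_zero, false_and, if_false,
      sub_zero] at h
    rw [h, ih (by omega)]
    congr 2
    ring

/-! ### Root functions in the domain of L -/

lemma mem_graphL_rootVec {b : ℝ} {σ : L2 b} {z : ℂ} {k : ℕ} (hk : k < mult b σ z) :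
    (rootVec b σ z k, z • rootVec b σ z k + if k = 0 then 0 else rootVec b σ z (k - 1)) ∈
      graphL b σ := by
  set f : L2 b := z • rootVec b σ z k + if k = 0 then 0 else rootVec b σ z (k - 1) with hf
  set v : ℝ → ℂ := fun x => z * rootFn b σ z k x + delay (fun j => rootFn b σ z j x) k with hv
  have hvc : Continuous v := by
    have := continuous_delay (continuous_rootFn b σ z) k
    fun_prop
  have hfv : f =ᵐ[vol b] v := by
    have h1 : ∀ j, rootVec b σ z j =ᵐ[vol b] rootFn b σ z j := fun j => MemLp.coeFn_toLp _
    filter_upwards [Lp.coeFn_add (z • rootVec b σ z k)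
      (if k = 0 then 0 else rootVec b σ z (k - 1)), Lp.coeFn_smul z (rootVec b σ z k), h1 k,
      h1 (k - 1), Lp.coeFn_zero ℂ 2 (vol b)] with x e1 e2 e3 e4 e5
    rw [hf, e1, Pi.add_apply, e2, Pi.smul_apply, e3, hv]
    cases k with
    | zero => simp only [if_true, e5, delay_zero, smul_eq_mul, Pi.zero_apply]
    | succ k => simpa using e4
  have hg : (Complex.I • f : L2 b) =ᵐ[vol b] fun x => Complex.I * v x := by
    filter_upwards [Lp.coeFn_smul Complex.I f, hfv] with x e1 e2
    rw [e1, Pi.smul_apply, e2, smul_eq_mul]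
  -- The derivative is `Complex.I • f` because -i(if) = f.
  refine ⟨rootFn b σ z k, Complex.I • f, (memLp_rootFn b σ z k).coeFn_toLp, fun x hx => ?_, ?_, ?_⟩
  · rw [intervalIntegral_congr_ae hx hg, intervalIntegral.integral_eq_sub_of_hasDerivAt
      (fun t _ => hasDerivAt_rootFn b σ z k t) ((hvc.const_mul _).intervalIntegrable _ _)]
    ring
  · have h := rootFn_zero_sub_pairing b σ z k
    rw [if_neg hk.ne] at h
    rw [← h, boundaryForm, pairing]
    congr 1
    refine integral_congr_ae ?_
    filter_upwards [hg] with x e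
    rw [e]
    linear_combination -(v x * starRingEnd ℂ (σ x)) * Complex.I_sq
  · rw [smul_smul]
    simp

lemma opL_rootVec {b : ℝ} {σ : L2 b} {z : ℂ} {k : ℕ} (hk : k < mult b σ z) :
    ∃ h : rootVec b σ z k ∈ (opL b σ).domain,
      opL b σ ⟨rootVec b σ z k, h⟩ - z • rootVec b σ z k =
        if k = 0 then 0 else rootVec b σ z (k - 1) := by
  have hmem := mem_graphL_rootVec hk
  rw [← (graphL b σ).toLinearPMap_graph_eq (graphL_single_valued b σ),
    LinearPMap.mem_graph_iff] at hmem
  obtain ⟨⟨y, hy⟩, h1, h2⟩ := hmem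
  simp only at h1 h2
  subst h1
  refine ⟨hy, ?_⟩
  have h3 : opL b σ ⟨rootVec b σ z k, hy⟩ = _ := h2
  rw [h3, add_sub_cancel_left]

/-! ### Minimality and the biorthogonal system -/

/-- The kernel of the continuous functional given by `w i` is closed and contains all other vectors,
but not `v i`. -/
lemma IsBiorthogonal.isMinimalSystem {H ι : Type*} [NormedAddCommGroup H]
    [InnerProductSpace ℂ H] {v w : ι → H} (h : IsBiorthogonal v w) : IsMinimalSystem v := by
  intro i hi
  have hle : (Submodule.span ℂ (v '' {i}ᶜ)).topologicalClosure ≤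
      LinearMap.ker (innerSL ℂ (w i)).toLinearMap := by
    refine Submodule.topologicalClosure_minimal _ (Submodule.span_le.2 ?_)
      (innerSL ℂ (w i)).isClosed_ker
    rintro _ ⟨j, hj, rfl⟩
    exact h.2 i j (Ne.symm hj)
  have h0 : inner ℂ (w i) (v i) = 0 := hle hi
  exact one_ne_zero ((h.1 i).symm.trans h0)

/-- The element `-conj h_k` of `L₂(0, b)`. -/
def dualVec (b : ℝ) (σ : L2 b) (z : ℂ) (k : ℕ) : L2 b := (memLp_hFn b σ z k).star.neg.toLp

lemma coeFn_dualVec (b : ℝ) (σ : L2 b) (z : ℂ) (k : ℕ) :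
    dualVec b σ z k =ᵐ[vol b] fun ξ => -starRingEnd ℂ (hFn b σ z k ξ) :=
  MemLp.coeFn_toLp _

lemma inner_dualVec_rootVec (b : ℝ) (σ : L2 b) (z z' : ℂ) (k s : ℕ) :
    inner ℂ (dualVec b σ z k) (rootVec b σ z' s) = -hPairing b σ z k (rootFn b σ z' s) := by
  rw [MeasureTheory.L2.inner_def, hPairing, ← integral_neg]
  refine integral_congr_ae ?_
  filter_upwards [coeFn_dualVec b σ z k, (memLp_rootFn b σ z' s).coeFn_toLp] with x h1 h2
  rw [h1, rootVec, h2]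
  simp [RCLike.inner_apply]

lemma isBiorthogonal_rootSystem (b : ℝ) (σ : L2 b) :
    IsBiorthogonal (rootSystem b σ)
      fun i => dualVec b σ i.1 (mult b σ i.1 - 1 - (i.2 : ℕ)) := by
  refine ⟨fun ⟨z, k⟩ => ?_, fun ⟨z, k⟩ ⟨z', s⟩ hne => ?_⟩
  · have hk := k.2
    simp only [rootSystem, inner_dualVec_rootVec]
    rw [hPairing_rootFn_self (by omega), if_pos (by omega), neg_neg]
  · have hk := k.2
    have hs := s.2
    simp only [rootSystem, inner_dualVec_rootVec]
    by_cases hz : z' = z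
    · subst hz
      have : (s : ℕ) ≠ k := fun h => hne (by rw [Fin.ext h.symm])
      -- As k < m, the subtraction is not truncated, and s + (m - 1 - k) + 1 = m only for s = k.
      rw [hPairing_rootFn_self (by omega), if_neg (by omega), neg_zero]
    · rw [hPairing_rootFn_of_ne (fun h => hz (Subtype.ext h)) hs (by omega), neg_zero]

end

end FirstOrderBVP

theorem theorem4p2 (b : ℝ) (hb : 0 < b) (σ : FirstOrderBVP.L2 b) :
    (∀ z ∈ FirstOrderBVP.spectrumSet (FirstOrderBVP.opL b σ),
      ∀ k < FirstOrderBVP.mult b σ z,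
        ∃ hk : FirstOrderBVP.rootVec b σ z k ∈ (FirstOrderBVP.opL b σ).domain,
          FirstOrderBVP.opL b σ ⟨FirstOrderBVP.rootVec b σ z k, hk⟩
              - z • FirstOrderBVP.rootVec b σ z k
            = if k = 0 then 0 else FirstOrderBVP.rootVec b σ z (k - 1)) ∧
    FirstOrderBVP.IsMinimalSystem (FirstOrderBVP.rootSystem b σ) ∧
    ∃ w : FirstOrderBVP.RootIndex b σ → FirstOrderBVP.L2 b,
      (∀ i, w i =ᵐ[FirstOrderBVP.vol b] fun ξ =>
        -starRingEnd ℂ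
          (FirstOrderBVP.hFn b σ i.1 (FirstOrderBVP.mult b σ i.1 - 1 - (i.2 : ℕ)) ξ)) ∧
      FirstOrderBVP.IsBiorthogonal (FirstOrderBVP.rootSystem b σ) w := by
  refine ⟨fun z _ k hk => FirstOrderBVP.opL_rootVec hk,
    (FirstOrderBVP.isBiorthogonal_rootSystem b σ).isMinimalSystem, _,
    fun i => FirstOrderBVP.coeFn_dualVec b σ _ _, FirstOrderBVP.isBiorthogonal_rootSystem b σ⟩
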